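/- Let $k$ be a field of characteristic zero. For a field $F$, an $F$-variety means a scheme together with a morphism of finite type to $\mathrm{Spec}\,F$ (it need not be separated, reduced or irreducible). Let $X$ be a non-empty $k$-variety. Then there exist a $\mathbb{Q}$-variety $Z$, an integral $\mathbb{Q}$-variety $T$ with function field $m = K(T)$, a dominant morphism $\pi : Z \to T$ of $\mathbb{Q}$-varieties, and a field embedding $m \hookrightarrow k$ such that $X$ is obtained by base extension from the generic fibre $Z_\eta = Z \times_T \mathrm{Spec}\, m$ of $\pi$; that is, there is an isomorphism of $k$-schemes $$X \;\cong\; Z_\eta \times_{\mathrm{Spec}\, m} \mathrm{Spec}\, k .$$ If $X$ is smooth over $k$, then $Z$ can be taken smooth over $\mathbb{Q}$. -/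

import Mathlib

open CategoryTheory CategoryTheory.Limits AlgebraicGeometry

universe u

/-- A scheme `X` with structure morphism `f : X ⟶ Spec k` is a `k`-variety if `f` is of finite
type, i.e. locally of finite type and quasi-compact. Separatedness, irreducibility and reducedness
are not required. -/
structure IsVariety {k : Type u} [Field k] {X : Scheme.{u}}
    (f : X ⟶ Spec (CommRingCat.of k)) : Prop where
  locallyOfFiniteType : LocallyOfFiniteType f
  quasiCompact : QuasiCompact f

/-- The generic fibre `Z_η = Z ×_T η` of `π : Z ⟶ T`, where `T` is integral and
`η = Spec K(T) ⟶ T` is its generic point. -/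
noncomputable def genericFibre {Z T : Scheme.{u}} [IsIntegral T] (π : Z ⟶ T) : Scheme.{u} :=
  pullback π (T.fromSpecStalk (genericPoint T))

/-- The structure morphism `Z_η ⟶ Spec K(T)` of the generic fibre. -/
noncomputable def genericFibreStr {Z T : Scheme.{u}} [IsIntegral T] (π : Z ⟶ T) :
    genericFibre π ⟶ Spec T.functionField :=
  pullback.snd π (T.fromSpecStalk (genericPoint T))

/-- The base extension `Y ×_{Spec m} Spec k` of `g : Y ⟶ Spec m` along a ring homomorphism
`ι : m ⟶ k`. -/
noncomputable def baseExtension {m k : CommRingCat.{u}} {Y : Scheme.{u}} (g : Y ⟶ Spec m)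
    (ι : m ⟶ k) : Scheme.{u} :=
  pullback g (Spec.map ι)

/-- The structure morphism of the base extension over `Spec k`. -/
noncomputable def baseExtensionStr {m k : CommRingCat.{u}} {Y : Scheme.{u}} (g : Y ⟶ Spec m)
    (ι : m ⟶ k) : baseExtension g ι ⟶ Spec k :=
  pullback.snd g (Spec.map ι)

/-! A scheme of finite type over `k` is described by finitely many polynomials: equations of affine
charts and gluing data. Their coefficients lie in a finitely generated subalgebra `A` of `k` over
the prime field `Q`, so `X` is the base change of some `Y` of finite type over `A`. Take `T = Spec
A`, which is integral. As `A` embeds in `k`, the map `Spec k ⟶ T` hits the generic point and factors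
through `Spec K(T)`; hence `X` is a base extension of the generic fibre.

Spreading out uses that `Spec k` is the cofiltered limit of the spectra of its finitely generated
subalgebras. An affine chart descends through a finite presentation (`exists_isPushout_adjoin`). Two
models of the same scheme agree at a finer level (`exists_isPullback_isPullback`), so models of two
open pieces can be glued along a common model of the overlap
(`HasModel.of_isPullback_of_isOpenImmersion`).

If `X` is smooth, faithfully flat descent along `K(T) ⟶ k` makes the generic fibre smooth over
`K(T)`, and `K(T)` is formally smooth over the perfect field `Q`. So `Y` is smooth over `Q` at every
point above the generic point (`Algebra.IsSmoothAt.of_smooth_tensorProduct`). The image of `X`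
consists of such points, and `Y` may be replaced by its smooth locus over `Q` without changing the
base change to `k`. -/

namespace AlgebraicGeometry.CofilteredDescent

/-! ### Base change of a cofiltered limit of schemes -/

variable {I : Type u} [Category.{u} I] {D : I ⥤ Scheme.{u}} {c : Cone D}

/-- The structure morphism of an object of `Over i`, with target `i`. -/
def overHom {i : I} (j : Over i) : j.left ⟶ i := j.hom

lemma left_comp_overHom {i : I} {j k : Over i} (h : j ⟶ k) : h.left ≫ overHom k = overHom j :=
  Over.w h

lemma map_left_comp_map_overHom {i : I} {j k : Over i} (h : j ⟶ k) :
    D.map h.left ≫ D.map (overHom k) = D.map (overHom j) := by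
  rw [← D.map_comp, left_comp_overHom]

/-- The transition maps of `baseChangeDiagram`. -/
noncomputable def baseChangeMap (D : I ⥤ Scheme.{u}) {i : I} {Y : Scheme.{u}}
    (p : Y ⟶ D.obj i) {j k : Over i} (h : j ⟶ k) :
    pullback (D.map (overHom j)) p ⟶ pullback (D.map (overHom k)) p :=
  pullback.lift (pullback.fst _ _ ≫ D.map h.left) (pullback.snd _ _)
    (by rw [Category.assoc, map_left_comp_map_overHom, pullback.condition])

lemma baseChangeMap_fst {i : I} {Y : Scheme.{u}} (p : Y ⟶ D.obj i) {j k : Over i} (h : j ⟶ k) :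
    baseChangeMap D p h ≫ pullback.fst _ _ = pullback.fst _ _ ≫ D.map h.left :=
  pullback.lift_fst _ _ _

lemma baseChangeMap_snd {i : I} {Y : Scheme.{u}} (p : Y ⟶ D.obj i) {j k : Over i} (h : j ⟶ k) :
    baseChangeMap D p h ≫ pullback.snd _ _ = pullback.snd _ _ :=
  pullback.lift_snd _ _ _

lemma isPullback_baseChangeMap {i : I} {Y : Scheme.{u}} (p : Y ⟶ D.obj i) {j k : Over i}
    (h : j ⟶ k) : IsPullback (baseChangeMap D p h) (pullback.fst (D.map (overHom j)) p)
      (pullback.fst (D.map (overHom k)) p) (D.map h.left) :=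
  IsPullback.of_right (h₁₂ := pullback.snd (D.map (overHom k)) p) (v₁₃ := p)
    (h₂₂ := D.map (overHom k))
    (by
      rw [baseChangeMap_snd, map_left_comp_map_overHom]
      exact (IsPullback.of_hasPullback _ _).flip)
    (baseChangeMap_fst p h) (IsPullback.of_hasPullback _ _).flip

/-- The diagram `j ↦ Dⱼ ×_{Dᵢ} Y` of base changes of `p : Y ⟶ Dᵢ`. -/
noncomputable def baseChangeDiagram (D : I ⥤ Scheme.{u}) {i : I} {Y : Scheme.{u}}
    (p : Y ⟶ D.obj i) : Over i ⥤ Scheme.{u} where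
  obj j := pullback (D.map (overHom j)) p
  map h := baseChangeMap D p h
  map_id j := by
    apply pullback.hom_ext <;> simp [baseChangeMap_fst, baseChangeMap_snd]
  map_comp f g := by
    apply pullback.hom_ext
    · rw [Category.assoc, baseChangeMap_fst, baseChangeMap_fst, ← Category.assoc,
        baseChangeMap_fst, Category.assoc, Over.comp_left, D.map_comp]
    · rw [Category.assoc, baseChangeMap_snd, baseChangeMap_snd, baseChangeMap_snd]

/-- The projection of `baseChangeDiagram D p` to `D`. -/
noncomputable def baseChangeDiagramFst (D : I ⥤ Scheme.{u}) {i : I} {Y : Scheme.{u}}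
    (p : Y ⟶ D.obj i) : baseChangeDiagram D p ⟶ Over.forget i ⋙ D where
  app j := pullback.fst (D.map (overHom j)) p
  naturality _ _ h := baseChangeMap_fst p h

/-- The projection of `baseChangeDiagram D p` to `Y`. -/
noncomputable def baseChangeDiagramSnd (D : I ⥤ Scheme.{u}) {i : I} {Y : Scheme.{u}}
    (p : Y ⟶ D.obj i) : baseChangeDiagram D p ⟶ (Functor.const _).obj Y where
  app j := pullback.snd (D.map (overHom j)) p
  naturality _ _ h := (baseChangeMap_snd p h).trans (Category.comp_id _).symm

/-- The comparison of base changes of `p` to `c.pt` and to `Dⱼ`. -/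
noncomputable def toLevel {i : I} {X Y : Scheme.{u}} {p : Y ⟶ D.obj i} {f : X ⟶ c.pt}
    {g : X ⟶ Y} (sq : IsPullback f g (c.π.app i) p) {j : I} (h : j ⟶ i) :
    X ⟶ pullback (D.map h) p :=
  pullback.lift (f ≫ c.π.app j) g (by rw [Category.assoc, c.w, sq.w])

section toLevel

variable {i : I} {X Y : Scheme.{u}} {p : Y ⟶ D.obj i} {f : X ⟶ c.pt}
    {g : X ⟶ Y} (sq : IsPullback f g (c.π.app i) p) {j : I} (h : j ⟶ i)

lemma toLevel_fst : toLevel sq h ≫ pullback.fst _ _ = f ≫ c.π.app j :=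
  pullback.lift_fst _ _ _

lemma toLevel_snd : toLevel sq h ≫ pullback.snd _ _ = g :=
  pullback.lift_snd _ _ _

lemma isPullback_toLevel : IsPullback f (toLevel sq h) (c.π.app j) (pullback.fst (D.map h) p) :=
  IsPullback.flip <|
  IsPullback.of_right (h₁₂ := pullback.snd (D.map h) p) (v₁₃ := p) (h₂₂ := D.map h)
    (by rw [toLevel_snd, c.w]; exact sq.flip) (toLevel_fst sq h)
    (IsPullback.of_hasPullback _ _).flip

end toLevel

/-- The cone over `baseChangeDiagram D p` given by a base change of `p` to `c.pt`. -/
noncomputable def baseChangeCone {i : I} {X Y : Scheme.{u}} {p : Y ⟶ D.obj i} {f : X ⟶ c.pt}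
    {g : X ⟶ Y} (sq : IsPullback f g (c.π.app i) p) : Cone (baseChangeDiagram D p) where
  pt := X
  π :=
  { app j := toLevel sq (overHom j)
    naturality j k h := by
      refine (Category.id_comp _).trans (pullback.hom_ext ?_ ?_)
      · change _ = (toLevel sq (overHom j) ≫ baseChangeMap D p h) ≫ _
        rw [Category.assoc, baseChangeMap_fst, toLevel_fst, ← Category.assoc, toLevel_fst,
          Category.assoc, c.w]
      · change _ = (toLevel sq (overHom j) ≫ baseChangeMap D p h) ≫ _
        rw [Category.assoc, baseChangeMap_snd, toLevel_snd, toLevel_snd] }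

/-- `baseChangeCone sq` is a limit cone. -/
noncomputable def isLimitBaseChangeCone [IsCofiltered I] (hc : IsLimit c) {i : I}
    {X Y : Scheme.{u}} {p : Y ⟶ D.obj i} {f : X ⟶ c.pt}
    {g : X ⟶ Y} (sq : IsPullback f g (c.π.app i) p) : IsLimit (baseChangeCone sq) :=
  -- `Over i` has a terminal object, hence is connected, and is initial in the cofiltered `I`. Over
  -- a connected index, a cone that is levelwise the pullback of a limit cone is itself a limit
  -- cone.
  have : IsConnected (Over i) := isConnected_of_hasTerminal _
  isLimitOfIsPullbackOfIsConnected (baseChangeDiagramFst D p) (baseChangeCone sq)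
    (c.whisker (Over.forget i))
    ⟨f, fun j ↦ (toLevel_fst sq (overHom j)).symm⟩
    (fun j ↦ (isPullback_toLevel sq (overHom j)).flip)
    ((Functor.Initial.isLimitWhiskerEquiv (Over.forget i) c).symm hc)

section

variable {i : I} {Y : Scheme.{u}} (p : Y ⟶ D.obj i)

instance compactSpace_pullback_map [∀ {i j} (f : i ⟶ j), IsAffineHom (D.map f)]
    [CompactSpace Y] {j : I} (h : j ⟶ i) : CompactSpace (pullback (D.map h) p : Scheme.{u}) :=
  have : QuasiCompact (pullback.snd (D.map h) p) := inferInstance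
  QuasiCompact.compactSpace_of_compactSpace (pullback.snd (D.map h) p)

instance isAffineHom_baseChangeDiagram_map [∀ {i j} (f : i ⟶ j), IsAffineHom (D.map f)]
    {j k : Over i} (h : j ⟶ k) : IsAffineHom ((baseChangeDiagram D p).map h) :=
  MorphismProperty.of_isPullback (isPullback_baseChangeMap p h).flip
    (inferInstanceAs (IsAffineHom (D.map h.left)))

instance compactSpace_baseChangeDiagram_obj [∀ {i j} (f : i ⟶ j), IsAffineHom (D.map f)]
    [CompactSpace Y] (j : Over i) : CompactSpace ((baseChangeDiagram D p).obj j) :=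
  compactSpace_pullback_map p (overHom j)

instance isLocallyNoetherian_baseChangeDiagram_obj [∀ i, IsLocallyNoetherian (D.obj i)]
    [LocallyOfFiniteType p] (j : Over i) : IsLocallyNoetherian ((baseChangeDiagram D p).obj j) :=
  inferInstanceAs (IsLocallyNoetherian (pullback (D.map (overHom j)) p))

end

section

variable [IsCofiltered I] [∀ {i j} (f : i ⟶ j), IsAffineHom (D.map f)]
  [∀ i, IsLocallyNoetherian (D.obj i)] (hc : IsLimit c)
  {i : I} {X Y Y' : Scheme.{u}} {p : Y ⟶ D.obj i} {p' : Y' ⟶ D.obj i} [LocallyOfFiniteType p]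
  [LocallyOfFiniteType p'] [CompactSpace Y] [CompactSpace Y'] {f : X ⟶ c.pt} {g : X ⟶ Y}
  {g' : X ⟶ Y'}

include hc

omit [CompactSpace Y'] in
/-- Morphisms from a base change to the limit into a scheme of finite type over `Dᵢ` exist at a
finite level. -/
lemma exists_toLevel_comp_eq (sq : IsPullback f g (c.π.app i) p) (hg' : g' ≫ p' = g ≫ p) :
    ∃ (j : I) (h : j ⟶ i) (φ : pullback (D.map h) p ⟶ Y'),
      φ ≫ p' = pullback.snd _ _ ≫ p ∧ toLevel sq h ≫ φ = g' := by
  -- Noetherian levels make `p'` of finite presentation and the diagram levelwise quasi-separated.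
  obtain ⟨j, φ, h₁, h₂⟩ := Scheme.exists_π_app_comp_eq_of_locallyOfFinitePresentation
    (baseChangeDiagram D p) (baseChangeDiagramSnd D p ≫ (Functor.const _).map p) p'
    (baseChangeCone sq) (isLimitBaseChangeCone hc sq) g' (by
      ext j : 2
      exact ((Category.assoc _ _ _).symm.trans
        (congr($(toLevel_snd sq (overHom j)) ≫ p))).trans hg'.symm)
  exact ⟨j.left, overHom j, φ, h₂, h₁⟩

omit [LocallyOfFiniteType p] [∀ i, IsLocallyNoetherian (D.obj i)] [CompactSpace Y'] in
/-- Morphisms from `Y` to a scheme of finite type over `Dᵢ` which agree on the base change to the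
limit agree at a finite level. -/
lemma exists_snd_comp_eq (sq : IsPullback f g (c.π.app i) p) (φ ψ : Y ⟶ Y') (hφ : φ ≫ p' = p)
    (hψ : ψ ≫ p' = p) (H : g ≫ φ = g ≫ ψ) :
    ∃ (j : I) (h : j ⟶ i), pullback.snd (D.map h) p ≫ φ = pullback.snd (D.map h) p ≫ ψ := by
  -- The starting level is the terminal object `𝟙 i` of `Over i`, where the diagram is `Y` up to the
  -- projection.
  obtain ⟨j, h, e⟩ := Scheme.exists_hom_comp_eq_comp_of_locallyOfFiniteType
    (baseChangeDiagram D p) (baseChangeDiagramSnd D p ≫ (Functor.const _).map p) p'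
    (baseChangeCone sq) (isLimitBaseChangeCone hc sq) (i := .mk (𝟙 i))
    (pullback.snd (D.map (overHom (.mk (𝟙 i)))) p ≫ φ)
    (pullback.snd (D.map (overHom (.mk (𝟙 i)))) p ≫ ψ)
    (congr(pullback.snd (D.map (overHom (.mk (𝟙 i)))) p ≫ $hφ).symm.trans
      (Category.assoc _ _ _).symm)
    (congr(pullback.snd (D.map (overHom (.mk (𝟙 i)))) p ≫ $hψ).symm.trans
      (Category.assoc _ _ _).symm)
    (by
      have := toLevel_snd sq (overHom (.mk (𝟙 i)))
      refine (Category.assoc _ _ _).symm.trans (.trans ?_ (Category.assoc _ _ _))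
      exact (congr($this ≫ φ).trans H).trans congr($this ≫ ψ).symm)
  refine ⟨j.left, overHom j, ?_⟩
  have h₂ := baseChangeMap_snd p h
  replace e : baseChangeMap D p h ≫ pullback.snd (D.map (overHom (.mk (𝟙 i)))) p ≫ φ =
    baseChangeMap D p h ≫ pullback.snd (D.map (overHom (.mk (𝟙 i)))) p ≫ ψ := e
  rwa [← Category.assoc, ← Category.assoc, h₂] at e

end

end AlgebraicGeometry.CofilteredDescent

/-! ### Models at a finite level and their uniqueness -/

/-- `φ` and `ψ` need not be inverse to each other: it suffices that they become so after base change
along `d`. -/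
lemma CategoryTheory.IsPullback.comp_of_inverse {C : Type*} [Category* C] {S T Y Y' P P' : C}
    {d : T ⟶ S} {p : Y ⟶ S} {p' : Y' ⟶ S} {a : P ⟶ T} {b : P ⟶ Y} {a' : P' ⟶ T} {b' : P' ⟶ Y'}
    (sq : IsPullback a b d p) (sq' : IsPullback a' b' d p') (φ : Y ⟶ Y') (ψ : Y' ⟶ Y)
    (hφ : φ ≫ p' = p) (hψ : ψ ≫ p = p') (h₁ : b ≫ φ ≫ ψ = b) (h₂ : b' ≫ ψ ≫ φ = b') :
    IsPullback a (b ≫ φ) d p' :=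
  IsPullback.of_iso sq'
    { hom := sq.lift a' (b' ≫ ψ) (by rw [Category.assoc, hψ, sq'.w])
      inv := sq'.lift a (b ≫ φ) (by rw [Category.assoc, hφ, sq.w])
      hom_inv_id := by apply sq'.hom_ext <;> simp [h₂]
      inv_hom_id := by apply sq.hom_ext <;> simp [h₁] }
    (Iso.refl _) (Iso.refl _) (Iso.refl _) (by simp) (by simp [h₂]) (by simp) (by simp)

namespace AlgebraicGeometry.CofilteredDescent

variable {I : Type u} [Category.{u} I] {D : I ⥤ Scheme.{u}} {c : Cone D}

/-- `f : X ⟶ c.pt` is the base change of the finite type morphism `p : Y ⟶ Dᵢ`, with `Y`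
quasi-compact, along `c.pt ⟶ Dᵢ`. -/
structure IsModel (c : Cone D) {i : I} {X Y : Scheme.{u}} (f : X ⟶ c.pt) (g : X ⟶ Y)
    (p : Y ⟶ D.obj i) : Prop where
  isPullback : IsPullback f g (c.π.app i) p
  locallyOfFiniteType : LocallyOfFiniteType p
  compactSpace : CompactSpace Y

section

variable {i : I} {X Y : Scheme.{u}} {p : Y ⟶ D.obj i} {f : X ⟶ c.pt} {g : X ⟶ Y}

lemma IsModel.toLevel [∀ {i j} (f : i ⟶ j), IsAffineHom (D.map f)] (m : IsModel c f g p) {j : I}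
    (h : j ⟶ i) : IsModel c f (toLevel m.isPullback h) (pullback.fst (D.map h) p) :=
  have := m.locallyOfFiniteType
  have := m.compactSpace
  ⟨isPullback_toLevel m.isPullback h, inferInstance, inferInstance⟩

/-- The comparison morphism of base changes to different levels. -/
noncomputable def levelMap (p : Y ⟶ D.obj i) {j k : I} (h : k ⟶ j) (h' : j ⟶ i) :
    pullback (D.map (h ≫ h')) p ⟶ pullback (D.map h') p :=
  pullback.lift (pullback.fst _ _ ≫ D.map h) (pullback.snd _ _)
    (by rw [Category.assoc, ← D.map_comp, pullback.condition])

lemma levelMap_fst (p : Y ⟶ D.obj i) {j k : I} (h : k ⟶ j) (h' : j ⟶ i) :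
    levelMap p h h' ≫ pullback.fst _ _ = pullback.fst _ _ ≫ D.map h :=
  pullback.lift_fst _ _ _

lemma levelMap_snd (p : Y ⟶ D.obj i) {j k : I} (h : k ⟶ j) (h' : j ⟶ i) :
    levelMap p h h' ≫ pullback.snd _ _ = pullback.snd _ _ :=
  pullback.lift_snd _ _ _

lemma toLevel_levelMap (sq : IsPullback f g (c.π.app i) p) {j k : I} (h : k ⟶ j) (h' : j ⟶ i) :
    CofilteredDescent.toLevel sq (h ≫ h') ≫ levelMap p h h' =
      CofilteredDescent.toLevel sq h' := by
  apply pullback.hom_ext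
  · rw [Category.assoc, levelMap_fst, toLevel_fst, ← Category.assoc, toLevel_fst, Category.assoc,
      c.w]
  · rw [Category.assoc, levelMap_snd, toLevel_snd, toLevel_snd]

end

section

variable [IsCofiltered I] [∀ {i j} (f : i ⟶ j), IsAffineHom (D.map f)]
  [∀ i, IsLocallyNoetherian (D.obj i)] (hc : IsLimit c)

include hc

omit [∀ i, IsLocallyNoetherian (D.obj i)] in
/-- Mutually inverse morphisms over `c.pt` between base changes become mutually inverse at a finite
level. -/
lemma exists_isPullback_snd_comp {i : I} {X Y Y' : Scheme.{u}} {p : Y ⟶ D.obj i}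
    {p' : Y' ⟶ D.obj i} {f : X ⟶ c.pt} {g : X ⟶ Y} {g' : X ⟶ Y'}
    (m : IsModel c f g p) (m' : IsModel c f g' p') (φ : Y ⟶ Y') (ψ : Y' ⟶ Y) (hφ : φ ≫ p' = p)
    (hψ : ψ ≫ p = p') (h₁ : g ≫ φ = g') (h₂ : g' ≫ ψ = g) :
    ∃ (j : I) (h : j ⟶ i), IsPullback (pullback.fst (D.map h) p) (pullback.snd (D.map h) p ≫ φ)
      (D.map h) p' := by
  have := m.locallyOfFiniteType
  have := m'.locallyOfFiniteType
  have := m.compactSpace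
  have := m'.compactSpace
  obtain ⟨j₁, k₁, e₁⟩ := exists_snd_comp_eq hc m.isPullback (φ ≫ ψ) (𝟙 Y)
    (by rw [Category.assoc, hψ, hφ]) (Category.id_comp _)
    (by rw [← Category.assoc, h₁, h₂, Category.comp_id])
  obtain ⟨j₂, k₂, e₂⟩ := exists_snd_comp_eq hc m'.isPullback (ψ ≫ φ) (𝟙 Y')
    (by rw [Category.assoc, hφ, hψ]) (Category.id_comp _)
    (by rw [← Category.assoc, h₂, h₁, Category.comp_id])
  -- A plain common refinement would not do: both routes must give the same morphism to `i`, so that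
  -- the two base changes are along one map.
  obtain ⟨j, l₁, l₂, e⟩ := IsCofiltered.cospan k₁ k₂
  refine ⟨j, l₁ ≫ k₁, ?_⟩
  have e₁' : pullback.snd (D.map (l₁ ≫ k₁)) p ≫ φ ≫ ψ = pullback.snd _ _ := by
    rw [← levelMap_snd, Category.assoc, e₁, Category.comp_id]
  have e₂' : pullback.snd (D.map (l₁ ≫ k₁)) p' ≫ ψ ≫ φ = pullback.snd _ _ := by
    rw [e, ← levelMap_snd, Category.assoc, e₂, Category.comp_id]
  generalize l₁ ≫ k₁ = h at *
  exact (IsPullback.of_hasPullback _ _).comp_of_inverse (IsPullback.of_hasPullback _ _) φ ψ hφ hψ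
    e₁' e₂'

/-- Two models of `X` become a common model at a finite level. -/
lemma exists_isPullback_isPullback {i : I} {X Y Y' : Scheme.{u}} {p : Y ⟶ D.obj i}
    {p' : Y' ⟶ D.obj i} {f : X ⟶ c.pt} {g : X ⟶ Y} {g' : X ⟶ Y'}
    (m : IsModel c f g p) (m' : IsModel c f g' p') :
    ∃ (j : I) (h : j ⟶ i) (Z : Scheme.{u}) (q : Z ⟶ D.obj j) (a : Z ⟶ Y) (a' : Z ⟶ Y')
      (g₀ : X ⟶ Z),
      IsModel c f g₀ q ∧ IsPullback q a (D.map h) p ∧ IsPullback q a' (D.map h) p' ∧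
      g₀ ≫ a = g ∧ g₀ ≫ a' = g' := by
  have := m.locallyOfFiniteType
  have := m'.locallyOfFiniteType
  have := m.compactSpace
  have := m'.compactSpace
  -- Each projection of `X` to one model descends to a morphism from a finite-level base change of
  -- the other model.
  obtain ⟨j₁, k₁, φ, hφ, hφ'⟩ := exists_toLevel_comp_eq hc m.isPullback (p' := p') (g' := g')
    (by rw [← m.isPullback.w, ← m'.isPullback.w])
  obtain ⟨j₂, k₂, ψ, hψ, hψ'⟩ := exists_toLevel_comp_eq hc m'.isPullback (p' := p) (g' := g)
    (by rw [← m.isPullback.w, ← m'.isPullback.w])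
  obtain ⟨j, l₁, l₂, e⟩ := IsCofiltered.cospan k₁ k₂
  obtain ⟨φ', hφ₁, hφ₁'⟩ : ∃ (φ' : pullback (D.map (l₁ ≫ k₁)) p ⟶ Y'),
      φ' ≫ p' = pullback.snd _ _ ≫ p ∧ toLevel m.isPullback (l₁ ≫ k₁) ≫ φ' = g' :=
    ⟨levelMap _ _ _ ≫ φ, by rw [Category.assoc, hφ, ← Category.assoc, levelMap_snd],
      by rw [← Category.assoc, toLevel_levelMap, hφ']⟩
  obtain ⟨ψ', hψ₁, hψ₁'⟩ : ∃ (ψ' : pullback (D.map (l₁ ≫ k₁)) p' ⟶ Y),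
      ψ' ≫ p = pullback.snd _ _ ≫ p' ∧ toLevel m'.isPullback (l₁ ≫ k₁) ≫ ψ' = g := by
    rw [e]
    exact ⟨levelMap _ _ _ ≫ ψ, by rw [Category.assoc, hψ, ← Category.assoc, levelMap_snd],
      by rw [← Category.assoc, toLevel_levelMap, hψ']⟩
  generalize l₁ ≫ k₁ = h at *
  generalize hy : toLevel m.isPullback h = y at *
  generalize hy' : toLevel m'.isPullback h = y' at *
  -- Lifted to the base changes at level `j`, `φ'` and `ψ'` are inverse on `X`, hence inverse at a
  -- finer level `k`. The common model is the base change of `Y` to `k`.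
  obtain ⟨k, l, sq⟩ := exists_isPullback_snd_comp hc (hy ▸ m.toLevel h) (hy' ▸ m'.toLevel h)
    (pullback.lift (pullback.fst _ _) φ' (by rw [hφ₁, pullback.condition]))
    (pullback.lift (pullback.fst _ _) ψ' (by rw [hψ₁, pullback.condition]))
    (pullback.lift_fst _ _ _) (pullback.lift_fst _ _ _)
    (by
      apply pullback.hom_ext
      · rw [Category.assoc, pullback.lift_fst, ← hy, ← hy', toLevel_fst, toLevel_fst]
      · rw [Category.assoc, pullback.lift_snd, hφ₁', ← hy', toLevel_snd])
    (by
      apply pullback.hom_ext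
      · rw [Category.assoc, pullback.lift_fst, ← hy, ← hy', toLevel_fst, toLevel_fst]
      · rw [Category.assoc, pullback.lift_snd, hψ₁', ← hy, toLevel_snd])
  refine ⟨k, l ≫ h, _, _, pullback.snd _ _ ≫ pullback.snd _ _,
    pullback.snd _ _ ≫ φ', _, (m.toLevel h).toLevel l,
    ?_, ?_, ?_, ?_⟩
  · rw [D.map_comp]
    exact (IsPullback.of_hasPullback _ _).paste_vert (IsPullback.of_hasPullback _ _)
  · rw [D.map_comp]
    simpa only [Category.assoc, pullback.lift_snd] using
      sq.paste_vert (IsPullback.of_hasPullback _ _)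
  · rw [← Category.assoc, toLevel_snd, toLevel_snd]
  · rw [← Category.assoc, toLevel_snd, hy, hφ₁']

omit [∀ i, IsLocallyNoetherian (D.obj i)] in
/-- Quasi-compact open subschemes descend to a finite level. -/
lemma exists_toLevel_preimage_eq {i : I} {X Y : Scheme.{u}} {p : Y ⟶ D.obj i}
    {f : X ⟶ c.pt} {g : X ⟶ Y} (m : IsModel c f g p) (U : X.Opens) (hU : IsCompact (U : Set X)) :
    ∃ (j : I) (h : j ⟶ i) (V : (pullback (D.map h) p).Opens),
      IsCompact (V : Set (pullback (D.map h) p : Scheme.{u})) ∧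
      CofilteredDescent.toLevel m.isPullback h ⁻¹ᵁ V = U := by
  obtain ⟨j, V, hV, e⟩ := exists_preimage_eq (baseChangeDiagram D p) (baseChangeCone m.isPullback)
    (isLimitBaseChangeCone hc m.isPullback) U hU
  exact ⟨j.left, overHom j, V, hV, e⟩

end

end AlgebraicGeometry.CofilteredDescent

/-! ### Gluing two schemes along an open subscheme -/

namespace AlgebraicGeometry

/-- The open cover given by two jointly surjective open immersions. -/
noncomputable def binaryOpenCover {X U V : Scheme.{u}} (j₁ : U ⟶ X) (j₂ : V ⟶ X)
    [IsOpenImmersion j₁] [IsOpenImmersion j₂]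
    (H : ∀ x : X, x ∈ Set.range j₁ ∨ x ∈ Set.range j₂) : X.OpenCover :=
  Scheme.Cover.mkOfCovers Bool (fun b ↦ Bool.rec U V b)
    (fun b ↦ match b with | false => j₁ | true => j₂)
    (fun x ↦ (H x).elim (fun ⟨y, hy⟩ ↦ ⟨false, y, hy⟩) (fun ⟨y, hy⟩ ↦ ⟨true, y, hy⟩))
    (fun b ↦ match b with | false => ‹_› | true => ‹_›)

lemma exists_glue_of_isPullback {X U V W Y : Scheme.{u}} {j₁ : U ⟶ X} {j₂ : V ⟶ X} {k₁ : W ⟶ U}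
    {k₂ : W ⟶ V} [IsOpenImmersion j₁] [IsOpenImmersion j₂]
    (H : ∀ x : X, x ∈ Set.range j₁ ∨ x ∈ Set.range j₂) (sq : IsPullback k₁ k₂ j₁ j₂)
    (a : U ⟶ Y) (b : V ⟶ Y) (h : k₁ ≫ a = k₂ ≫ b) :
    ∃ g : X ⟶ Y, j₁ ≫ g = a ∧ j₂ ≫ g = b := by
  let 𝒰 := binaryOpenCover j₁ j₂ H
  let F : ∀ x, 𝒰.X x ⟶ Y := fun x ↦ match x with | false => a | true => b
  have h' : pullback.fst j₁ j₂ ≫ a = pullback.snd j₁ j₂ ≫ b := by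
    rw [← sq.isoPullback_inv_fst, ← sq.isoPullback_inv_snd, Category.assoc, Category.assoc, h]
  have hF : ∀ x y, pullback.fst (𝒰.f x) (𝒰.f y) ≫ F x = pullback.snd _ _ ≫ F y := fun x y ↦
    match x, y with
    | false, false => congr($((cancel_mono j₁).mp pullback.condition) ≫ a)
    | true, true => congr($((cancel_mono j₂).mp pullback.condition) ≫ b)
    | false, true => h'
    | true, false => by
      change pullback.fst j₂ j₁ ≫ b = pullback.snd j₂ j₁ ≫ a
      rw [← pullbackSymmetry_hom_comp_fst, ← pullbackSymmetry_hom_comp_snd, Category.assoc,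
        Category.assoc, h']
  exact ⟨𝒰.glueMorphisms F hF, 𝒰.ι_glueMorphisms F hF false, 𝒰.ι_glueMorphisms F hF true⟩

/-- Being a pullback square can be checked on an open cover of one of the corners. -/
lemma isPullback_of_openCover_of_isPullback {X Y S T : Scheme.{u}} {g : X ⟶ Y} {f : X ⟶ T}
    {p : Y ⟶ S} {β : T ⟶ S} (𝒰 : Y.OpenCover) {U : 𝒰.I₀ → Scheme.{u}} (j : ∀ i, U i ⟶ X)
    (g' : ∀ i, U i ⟶ 𝒰.X i) (sq : ∀ i, IsPullback (j i) (g' i) g (𝒰.f i))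
    (sq' : ∀ i, IsPullback (g' i) (j i ≫ f) (𝒰.f i ≫ p) β) : IsPullback g f p β := by
  refine Scheme.isPullback_of_openCover g f p β 𝒰 fun i ↦ ?_
  refine (sq' i).of_iso (sq i).isoPullback (Iso.refl _) (Iso.refl _) (Iso.refl _) ?_ ?_
    (by simp) (by simp)
  · exact (Category.comp_id _).trans (sq i).isoPullback_hom_snd.symm
  · refine (Category.comp_id _).trans ?_
    refine .trans ?_ (Category.assoc _ _ _)
    exact congr($((sq i).isoPullback_hom_fst.symm) ≫ f)

section pushout

variable {W Y₁ Y₂ : Scheme.{u}} (o₁ : W ⟶ Y₁) (o₂ : W ⟶ Y₂) [IsOpenImmersion o₁]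
  [IsOpenImmersion o₂]

lemma exists_glued_of_isOpenImmersion : ∃ (Y : Scheme.{u}) (i₁ : Y₁ ⟶ Y) (i₂ : Y₂ ⟶ Y),
    IsOpenImmersion i₁ ∧ IsOpenImmersion i₂ ∧ IsPullback o₁ o₂ i₁ i₂ ∧
    ∀ y : Y, y ∈ Set.range i₁ ∨ y ∈ Set.range i₂ := by
  let F : WidePushoutShape WalkingPair ⥤ Scheme.{u} := span o₁ o₂
  have {i j : WidePushoutShape WalkingPair} (t : i ⟶ j) : IsOpenImmersion (F.map t) := by
    obtain (a | (a | a)) := t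
    · simp only [WidePushoutShape.hom_id, CategoryTheory.Functor.map_id]
      infer_instance
    · exact ‹IsOpenImmersion o₁›
    · exact ‹IsOpenImmersion o₂›
  have hF (i : WidePushoutShape WalkingPair) : IsOpenImmersion (colimit.ι F i) := inferInstance
  let i₁ : Y₁ ⟶ colimit F := colimit.ι F (some .left)
  let i₂ : Y₂ ⟶ colimit F := colimit.ι F (some .right)
  have hi₁ : IsOpenImmersion i₁ := hF _
  have hi₂ : IsOpenImmersion i₂ := hF _
  have h₁ : o₁ ≫ i₁ = colimit.ι F none := colimit.w F WalkingSpan.Hom.fst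
  have h₂ : o₂ ≫ i₂ = colimit.ι F none := colimit.w F WalkingSpan.Hom.snd
  refine ⟨colimit F, i₁, i₂, hi₁, hi₂, ?_, ?_⟩
  · refine IsOpenImmersion.isPullback _ _ _ _ (h₂.trans h₁.symm) (le_antisymm ?_ ?_)
    · rintro y ⟨x, hx⟩
      -- Points of the two legs are identified only through an index mapping to both, which must be
      -- the apex `none`.
      obtain ⟨k, a, b, z, -, hz⟩ := (Scheme.IsLocallyDirected.ι_eq_ι_iff F).mp hx
      match k, a, b, z, hz with
      | none, .init _, .init _, z, hz => exact ⟨z, hz⟩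
    · rintro _ ⟨w, rfl⟩
      exact ⟨o₁ w, congr($(h₁.trans h₂.symm) w)⟩
  · intro y
    obtain ⟨i, x, rfl⟩ := Scheme.IsLocallyDirected.ι_jointly_surjective F y
    obtain (_ | _ | _) := i
    · exact .inl ⟨o₁ x, congr($h₁ x)⟩
    · exact .inl ⟨x, rfl⟩
    · exact .inr ⟨x, rfl⟩

end pushout

end AlgebraicGeometry

namespace AlgebraicGeometry

lemma exists_eq_of_isPullback {P X Y Z : Scheme.{u}} {a : P ⟶ X} {b : P ⟶ Y} {f : X ⟶ Z}
    {g : Y ⟶ Z} (sq : IsPullback a b f g) (x : X) (y : Y) (h : f x = g y) :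
    ∃ z : P, a z = x ∧ b z = y := by
  obtain ⟨z, hx, hy⟩ := Scheme.Pullback.exists_preimage_pullback x y h
  exact ⟨sq.isoPullback.inv z, by rw [← hx, ← sq.isoPullback_inv_fst]; rfl,
    by rw [← hy, ← sq.isoPullback_inv_snd]; rfl⟩

/-- Glue two schemes over `S` along open immersions, and identify the base change to `T`. -/
lemma exists_isPullback_of_isOpenImmersion {X U V W T S Y₁ Y₂ W' : Scheme.{u}} {f : X ⟶ T}
    {β : T ⟶ S} {j₁ : U ⟶ X} {j₂ : V ⟶ X} {k₁ : W ⟶ U} {k₂ : W ⟶ V} [IsOpenImmersion j₁]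
    [IsOpenImmersion j₂] (H : ∀ x : X, x ∈ Set.range j₁ ∨ x ∈ Set.range j₂)
    (sq : IsPullback k₁ k₂ j₁ j₂) {p₁ : Y₁ ⟶ S} {p₂ : Y₂ ⟶ S} {g₁ : U ⟶ Y₁} {g₂ : V ⟶ Y₂}
    {o₁ : W' ⟶ Y₁} {o₂ : W' ⟶ Y₂} [IsOpenImmersion o₁] [IsOpenImmersion o₂] {gW : W ⟶ W'}
    (m₁ : IsPullback (j₁ ≫ f) g₁ β p₁) (m₂ : IsPullback (j₂ ≫ f) g₂ β p₂)
    (hp : o₁ ≫ p₁ = o₂ ≫ p₂) (sq₁ : IsPullback k₁ gW g₁ o₁) (sq₂ : IsPullback k₂ gW g₂ o₂) :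
    ∃ (Y : Scheme.{u}) (p : Y ⟶ S) (g : X ⟶ Y) (i₁ : Y₁ ⟶ Y) (i₂ : Y₂ ⟶ Y),
      IsOpenImmersion i₁ ∧ IsOpenImmersion i₂ ∧ i₁ ≫ p = p₁ ∧ i₂ ≫ p = p₂ ∧
      (∀ y : Y, y ∈ Set.range i₁ ∨ y ∈ Set.range i₂) ∧ IsPullback f g β p := by
  obtain ⟨Y, i₁, i₂, hi₁, hi₂, sqY, hY⟩ := exists_glued_of_isOpenImmersion o₁ o₂
  obtain ⟨p, hp₁, hp₂⟩ := exists_glue_of_isPullback hY sqY p₁ p₂ hp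
  obtain ⟨g, hg₁, hg₂⟩ := exists_glue_of_isPullback H sq (g₁ ≫ i₁) (g₂ ≫ i₂) (by
    rw [← Category.assoc, sq₁.w, ← Category.assoc, sq₂.w, Category.assoc, sqY.w, Category.assoc])
  -- The preimage of `Y₁` is no larger than `U`: a point of `V` landing in `Y₁` lands in the overlap
  -- `W'`, hence comes from `W` by `sq₂`.
  have t₁ : IsPullback j₁ g₁ g i₁ := by
    refine (IsOpenImmersion.isPullback g₁ j₁ i₁ g hg₁ (le_antisymm ?_ ?_)).flip
    · rintro x ⟨y, hy⟩
      obtain (⟨u, rfl⟩ | ⟨v, rfl⟩) := H x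
      · exact ⟨u, rfl⟩
      · obtain ⟨w', -, hw'⟩ := exists_eq_of_isPullback sqY y (g₂ v) (hy.trans congr($hg₂ v))
        obtain ⟨w, rfl, -⟩ := exists_eq_of_isPullback sq₂ v w' hw'.symm
        exact ⟨k₁ w, congr($sq.w w)⟩
    · rintro _ ⟨u, rfl⟩
      exact ⟨g₁ u, congr($hg₁.symm u)⟩
  have t₂ : IsPullback j₂ g₂ g i₂ := by
    refine (IsOpenImmersion.isPullback g₂ j₂ i₂ g hg₂ (le_antisymm ?_ ?_)).flip
    · rintro x ⟨y, hy⟩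
      obtain (⟨u, rfl⟩ | ⟨v, rfl⟩) := H x
      · obtain ⟨w', hw', -⟩ := exists_eq_of_isPullback sqY (g₁ u) y
          (congr($hg₁.symm u).trans hy.symm)
        obtain ⟨w, rfl, -⟩ := exists_eq_of_isPullback sq₁ u w' hw'.symm
        exact ⟨k₂ w, congr($sq.w.symm w)⟩
      · exact ⟨v, rfl⟩
    · rintro _ ⟨v, rfl⟩
      exact ⟨g₂ v, congr($hg₂.symm v)⟩
  refine ⟨Y, p, g, i₁, i₂, hi₁, hi₂, hp₁, hp₂, hY, IsPullback.flip ?_⟩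
  exact isPullback_of_openCover_of_isPullback (binaryOpenCover i₁ i₂ hY)
    (U := fun b ↦ match b with | false => U | true => V)
    (fun b ↦ match b with | false => j₁ | true => j₂)
    (fun b ↦ match b with | false => g₁ | true => g₂)
    (fun b ↦ match b with | false => t₁ | true => t₂)
    (fun b ↦ match b with
      | false => by subst hp₁; exact m₁.flip
      | true => by subst hp₂; exact m₂.flip)

/-! ### Gluing models -/

namespace CofilteredDescent

variable {I : Type u} [Category.{u} I] {D : I ⥤ Scheme.{u}} {c : Cone D}

/-- `f : X ⟶ c.pt` is the base change of a finite type morphism from a quasi-compact scheme to some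
`Dᵢ`. -/
def HasModel (c : Cone D) {X : Scheme.{u}} (f : X ⟶ c.pt) : Prop :=
  ∃ (i : I) (Y : Scheme.{u}) (p : Y ⟶ D.obj i) (g : X ⟶ Y), IsModel c f g p

variable [IsCofiltered I] [∀ {i j} (f : i ⟶ j), IsAffineHom (D.map f)]
  [∀ i, IsLocallyNoetherian (D.obj i)] (hc : IsLimit c)

include hc

/-- The overlap `W` inherits a model from each side, as an open subscheme. By uniqueness the two
agree at a finer level, where the models of `U` and `V` can be glued along it. -/
lemma HasModel.of_isPullback_of_isOpenImmersion {X U V W : Scheme.{u}} {f : X ⟶ c.pt}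
    {j₁ : U ⟶ X} {j₂ : V ⟶ X} {k₁ : W ⟶ U} {k₂ : W ⟶ V} [IsOpenImmersion j₁]
    [IsOpenImmersion j₂] [IsOpenImmersion k₁] [IsOpenImmersion k₂] [CompactSpace W]
    (H : ∀ x : X, x ∈ Set.range j₁ ∨ x ∈ Set.range j₂) (sq : IsPullback k₁ k₂ j₁ j₂)
    (h₁ : HasModel c (j₁ ≫ f)) (h₂ : HasModel c (j₂ ≫ f)) : HasModel c f := by
  -- Spread out the overlap as an open subscheme of both models, at a common level.
  obtain ⟨i, Y₁, p₁, g₁, Y₂, p₂, g₂, m₁, m₂, O₁, O₂, hO₁, hO₂⟩ :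
      ∃ (i : I) (Y₁ : Scheme.{u}) (p₁ : Y₁ ⟶ D.obj i) (g₁ : U ⟶ Y₁) (Y₂ : Scheme.{u})
        (p₂ : Y₂ ⟶ D.obj i) (g₂ : V ⟶ Y₂) (_ : IsModel c (j₁ ≫ f) g₁ p₁)
        (_ : IsModel c (j₂ ≫ f) g₂ p₂) (O₁ : Y₁.Opens) (O₂ : Y₂.Opens),
        g₁ ⁻¹ᵁ O₁ = k₁.opensRange ∧ g₂ ⁻¹ᵁ O₂ = k₂.opensRange := by
    obtain ⟨i₁, Y₁, p₁, g₁, m₁⟩ := h₁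
    obtain ⟨i₂, Y₂, p₂, g₂, m₂⟩ := h₂
    obtain ⟨l₁, a₁, O₁, -, hO₁⟩ := exists_toLevel_preimage_eq hc m₁ k₁.opensRange
      (isCompact_range k₁.continuous)
    obtain ⟨l₂, a₂, O₂, -, hO₂⟩ := exists_toLevel_preimage_eq hc m₂ k₂.opensRange
      (isCompact_range k₂.continuous)
    refine ⟨IsCofiltered.min l₁ l₂, _, _, _, _, _, _,
      m₁.toLevel (IsCofiltered.minToLeft l₁ l₂ ≫ a₁),
      m₂.toLevel (IsCofiltered.minToRight l₁ l₂ ≫ a₂),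
      levelMap _ _ _ ⁻¹ᵁ O₁, levelMap _ _ _ ⁻¹ᵁ O₂, ?_, ?_⟩
    · rw [← Scheme.Hom.comp_preimage, toLevel_levelMap, hO₁]
    · rw [← Scheme.Hom.comp_preimage, toLevel_levelMap, hO₂]
  have := m₁.locallyOfFiniteType
  have := m₂.locallyOfFiniteType
  have := m₁.compactSpace
  have := m₂.compactSpace
  have : IsNoetherian Y₁ := { __ := LocallyOfFiniteType.isLocallyNoetherian p₁ }
  have : IsNoetherian Y₂ := { __ := LocallyOfFiniteType.isLocallyNoetherian p₂ }
  have hr {U Y : Scheme.{u}} {k : W ⟶ U} [IsOpenImmersion k] {g : U ⟶ Y} {O : Y.Opens}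
      (hO : g ⁻¹ᵁ O = k.opensRange) : Set.range (k ≫ g) ⊆ Set.range O.ι := by
    rintro _ ⟨x, rfl⟩
    rw [Scheme.Opens.range_ι]
    have : k x ∈ g ⁻¹ᵁ O := hO ▸ ⟨x, rfl⟩
    exact this
  -- Every open subset of a Noetherian space is quasi-compact, so `O₁` and `O₂` qualify as models of
  -- `W`.
  have (O : Y₁.Opens) : CompactSpace O :=
    isCompact_iff_compactSpace.mp (TopologicalSpace.NoetherianSpace.isCompact _)
  have (O : Y₂.Opens) : CompactSpace O :=
    isCompact_iff_compactSpace.mp (TopologicalSpace.NoetherianSpace.isCompact _)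
  let w₁ : W ⟶ O₁ := IsOpenImmersion.lift O₁.ι (k₁ ≫ g₁) (hr hO₁)
  let w₂ : W ⟶ O₂ := IsOpenImmersion.lift O₂.ι (k₂ ≫ g₂) (hr hO₂)
  have hw₁ : w₁ ≫ O₁.ι = k₁ ≫ g₁ := IsOpenImmersion.lift_fac _ _ _
  have hw₂ : w₂ ≫ O₂.ι = k₂ ≫ g₂ := IsOpenImmersion.lift_fac _ _ _
  have t₁ : IsPullback k₁ w₁ g₁ O₁.ι :=
    (IsOpenImmersion.isPullback w₁ k₁ O₁.ι g₁ hw₁.symm (by rw [O₁.opensRange_ι, hO₁])).flip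
  have t₂ : IsPullback k₂ w₂ g₂ O₂.ι :=
    (IsOpenImmersion.isPullback w₂ k₂ O₂.ι g₂ hw₂.symm (by rw [O₂.opensRange_ι, hO₂])).flip
  have n₁ : IsModel c (k₁ ≫ j₁ ≫ f) w₁ (O₁.ι ≫ p₁) :=
    ⟨t₁.paste_horiz m₁.isPullback, inferInstance, inferInstance⟩
  have n₂ : IsModel c (k₁ ≫ j₁ ≫ f) w₂ (O₂.ι ≫ p₂) := by
    rw [← Category.assoc, sq.w, Category.assoc]
    exact ⟨t₂.paste_horiz m₂.isPullback, inferInstance, inferInstance⟩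
  obtain ⟨j, h, Z, q, a₁, a₂, g₀, n₀, s₁, s₂, ha₁, ha₂⟩ := exists_isPullback_isPullback hc n₁ n₂
  let o₁ : Z ⟶ pullback (D.map h) p₁ := pullback.lift q (a₁ ≫ O₁.ι) (by simpa using s₁.w)
  let o₂ : Z ⟶ pullback (D.map h) p₂ := pullback.lift q (a₂ ≫ O₂.ι) (by simpa using s₂.w)
  have r₁ : IsPullback o₁ a₁ (pullback.snd (D.map h) p₁) O₁.ι :=
    IsPullback.of_right (h₁₂ := pullback.fst _ _) (v₁₃ := D.map h) (h₂₂ := p₁)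
      (by rw [pullback.lift_fst]; exact s₁) (pullback.lift_snd _ _ _)
      (IsPullback.of_hasPullback _ _)
  have r₂ : IsPullback o₂ a₂ (pullback.snd (D.map h) p₂) O₂.ι :=
    IsPullback.of_right (h₁₂ := pullback.fst _ _) (v₁₃ := D.map h) (h₂₂ := p₂)
      (by rw [pullback.lift_fst]; exact s₂) (pullback.lift_snd _ _ _)
      (IsPullback.of_hasPullback _ _)
  have : IsOpenImmersion o₁ := MorphismProperty.of_isPullback r₁.flip inferInstance
  have : IsOpenImmersion o₂ := MorphismProperty.of_isPullback r₂.flip inferInstance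
  -- Cancel the cartesian square `r₁` from the square `t₁` at the original level.
  have u₁ : IsPullback k₁ g₀ (toLevel m₁.isPullback h) o₁ := by
    refine (IsPullback.of_right (h₁₂ := a₁) (v₁₃ := O₁.ι) (h₂₂ := pullback.snd (D.map h) p₁)
      ?_ ?_ r₁.flip).flip
    · rw [ha₁, toLevel_snd]
      exact t₁.flip
    · apply pullback.hom_ext
      · rw [Category.assoc, Category.assoc, toLevel_fst, pullback.lift_fst, ← n₀.isPullback.w]
        simp only [Category.assoc]
      · rw [Category.assoc, Category.assoc, toLevel_snd, pullback.lift_snd, ← Category.assoc, ha₁,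
          hw₁]
  have u₂ : IsPullback k₂ g₀ (toLevel m₂.isPullback h) o₂ := by
    refine (IsPullback.of_right (h₁₂ := a₂) (v₁₃ := O₂.ι) (h₂₂ := pullback.snd (D.map h) p₂)
      ?_ ?_ r₂.flip).flip
    · rw [ha₂, toLevel_snd]
      exact t₂.flip
    · apply pullback.hom_ext
      · rw [Category.assoc, Category.assoc, toLevel_fst, pullback.lift_fst, ← n₀.isPullback.w]
        rw [← Category.assoc k₁, sq.w]
        simp only [Category.assoc]
      · rw [Category.assoc, Category.assoc, toLevel_snd, pullback.lift_snd, ← Category.assoc, ha₂,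
          hw₂]
  obtain ⟨Y, p, g, i₁, i₂, hi₁, hi₂, hp₁, hp₂, hY, sqY⟩ := exists_isPullback_of_isOpenImmersion H sq
    (m₁.toLevel h).isPullback (m₂.toLevel h).isPullback
    ((pullback.lift_fst _ _ _).trans (pullback.lift_fst _ _ _).symm) u₁ u₂
  refine ⟨j, Y, p, g, sqY, ?_, ?_⟩
  · have : IsZariskiLocalAtSource @LocallyOfFiniteType.{u} :=
      HasRingHomProperty.instIsZariskiLocalAtSource (Q := RingHom.FiniteType)
    refine (IsZariskiLocalAtSource.iff_of_openCover (P := @LocallyOfFiniteType)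
      (binaryOpenCover i₁ i₂ hY)).mpr fun b ↦ ?_
    match b with
    | false => exact hp₁ ▸ inferInstanceAs (LocallyOfFiniteType (pullback.fst (D.map h) p₁))
    | true => exact hp₂ ▸ inferInstanceAs (LocallyOfFiniteType (pullback.fst (D.map h) p₂))
  · refine ⟨?_⟩
    rw [← Set.eq_univ_of_forall hY]
    exact (isCompact_range i₁.continuous).union (isCompact_range i₂.continuous)

end CofilteredDescent

end AlgebraicGeometry

/-! ### Descent to finitely generated subalgebras -/

namespace AlgebraicGeometry

section

variable (R : Type*) (A : Type u) [CommRing R] [CommRing A] [Algebra R A]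

/-- The filtered diagram of the finitely generated subalgebras of an algebra. -/
noncomputable def adjoinDiagram : Finset A ⥤ CommRingCat.{u} where
  obj s := CommRingCat.of (Algebra.adjoin R (s : Set A))
  map h := CommRingCat.ofHom
    (Subalgebra.inclusion (Algebra.adjoin_mono (Finset.coe_subset.mpr (leOfHom h)))).toRingHom

/-- An algebra as a cocone over its finitely generated subalgebras. -/
noncomputable def adjoinCocone : Cocone (adjoinDiagram R A) where
  pt := CommRingCat.of A
  ι := { app s := CommRingCat.ofHom (Algebra.adjoin R (s : Set A)).val.toRingHom }

/-- An algebra is the colimit of its finitely generated subalgebras. -/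
noncomputable def isColimitAdjoinCocone : IsColimit (adjoinCocone R A) := by
  classical
  have : ReflectsColimit (adjoinDiagram R A) (forget CommRingCat.{u}) :=
    reflectsColimit_of_reflectsIsomorphisms _ _
  refine isColimitOfReflects (forget CommRingCat.{u}) (Types.FilteredColimit.isColimitOf' _ _ ?_ ?_)
  · intro (x : A)
    exact ⟨{x}, (⟨x, Algebra.subset_adjoin (Finset.mem_coe.mpr (Finset.mem_singleton_self _))⟩ :
      Algebra.adjoin R (({x} : Finset A) : Set A)),
      rfl⟩
  -- The maps into `A` are injective, so elements with equal image are already equal at level `i`.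
  · intro i x y h
    exact ⟨i, 𝟙 _,
      congr(((forget CommRingCat.{u}).map ((adjoinDiagram R A).map (𝟙 i))) $(Subtype.ext h))⟩

/-- The spectra of the finitely generated subalgebras of an algebra. -/
noncomputable abbrev specAdjoinDiagram : (Finset A)ᵒᵖ ⥤ Scheme.{u} :=
  (adjoinDiagram R A).op ⋙ Scheme.Spec

/-- The spectrum of an algebra as a cone over the spectra of its finitely generated subalgebras. -/
noncomputable abbrev specAdjoinCone : Cone (specAdjoinDiagram R A) :=
  Scheme.Spec.mapCone (adjoinCocone R A).op

/-- The spectrum of an algebra is the limit of the spectra of its finitely generated subalgebras. -/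
noncomputable def isLimitSpecAdjoinCone : IsLimit (specAdjoinCone R A) :=
  isLimitOfPreserves Scheme.Spec (isColimitAdjoinCocone R A).op

instance {s t : (Finset A)ᵒᵖ} (h : s ⟶ t) : IsAffineHom ((specAdjoinDiagram R A).map h) := by
  dsimp
  infer_instance

instance [IsNoetherianRing R] (s : (Finset A)ᵒᵖ) :
    IsNoetherian ((specAdjoinDiagram R A).obj s) := by
  have : Algebra.FiniteType R (Algebra.adjoin R (s.unop : Set A)) :=
    .adjoin_of_finite s.unop.finite_toSet
  have : IsNoetherianRing (Algebra.adjoin R (s.unop : Set A)) :=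
    Algebra.FiniteType.isNoetherianRing R _
  change IsNoetherian (Spec (CommRingCat.of (Algebra.adjoin R (s.unop : Set A))))
  infer_instance

end

/-- A finite presentation involves finitely many coefficients. Adjoining them to `R` gives a
subalgebra over which the same generators and relations define `B₀`. -/
lemma exists_isPushout_adjoin (R : Type*) (A B : Type u) [CommRing R] [CommRing A] [CommRing B]
    [Algebra R A] [Algebra A B] [Algebra.FinitePresentation A B] :
    ∃ (s : Finset A) (B₀ : Type u) (_ : CommRing B₀) (_ : Algebra (Algebra.adjoin R (s : Set A)) B₀)
      (_ : Algebra.FiniteType (Algebra.adjoin R (s : Set A)) B₀) (j : B₀ →+* B),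
      IsPushout (CommRingCat.ofHom (Algebra.adjoin R (s : Set A)).val.toRingHom)
        (CommRingCat.ofHom (algebraMap (Algebra.adjoin R (s : Set A)) B₀))
        (CommRingCat.ofHom (algebraMap A B)) (CommRingCat.ofHom j) := by
  obtain ⟨n, m, ⟨P⟩⟩ := Algebra.Presentation.exists_presentation_fin A B
  let s : Finset A := P.finite_coeffs.toFinset
  let A₀ := Algebra.adjoin R (s : Set A)
  have : P.HasCoeffs A₀ := ⟨fun x hx ↦
    ⟨⟨x, Algebra.subset_adjoin (P.finite_coeffs.mem_toFinset.mpr hx)⟩, rfl⟩⟩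
  let e := P.tensorModelOfHasCoeffsEquiv A₀
  refine ⟨s, P.ModelOfHasCoeffs A₀, inferInstance, inferInstance, inferInstance,
    e.toRingHom.comp Algebra.TensorProduct.includeRight.toRingHom, ?_⟩
  refine (CommRingCat.isPushout_tensorProduct A₀ A (P.ModelOfHasCoeffs A₀)).of_iso (Iso.refl _)
    (Iso.refl _) (Iso.refl _) e.toRingEquiv.toCommRingCatIso ?_ ?_ ?_ ?_
  · rfl
  · rfl
  · ext x
    exact e.commutes x
  · rfl

namespace CofilteredDescent

lemma HasModel.of_isAffine (R : Type*) (A : Type u) [CommRing R] [CommRing A] [Algebra R A]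
    {X : Scheme.{u}} [IsAffine X] (f : X ⟶ Spec (CommRingCat.of A))
    [LocallyOfFinitePresentation f] : HasModel (specAdjoinCone R A) f := by
  obtain ⟨φ, hφ⟩ : ∃ φ : CommRingCat.of A ⟶ Γ(X, ⊤), X.isoSpec.inv ≫ f = Spec.map φ :=
    ⟨Spec.preimage _, (Spec.map_preimage _).symm⟩
  have hφ' : φ.hom.FinitePresentation := by
    rw [← LocallyOfFinitePresentation.SpecMap_iff, ← hφ]
    infer_instance
  algebraize [φ.hom]
  obtain ⟨s, B₀, _, _, _, j, sq⟩ := exists_isPushout_adjoin R A Γ(X, ⊤)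
  refine ⟨.op s, Spec (CommRingCat.of B₀), Spec.map (CommRingCat.ofHom (algebraMap _ B₀)),
    X.isoSpec.hom ≫ Spec.map (CommRingCat.ofHom j), ?_, ?_, ?_⟩
  · refine (isPullback_SpecMap_of_isPushout _ _ _ _ sq).of_iso X.isoSpec.symm (Iso.refl _)
      (Iso.refl _) (Iso.refl _) ?_ ?_ ?_ ?_
    · exact (Category.comp_id _).trans hφ.symm
    · exact (Category.comp_id _).trans (X.isoSpec.inv_hom_id_assoc _).symm
    · exact (Category.comp_id _).trans (Category.id_comp _).symm
    · exact (Category.comp_id _).trans (Category.id_comp _).symm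
  · change LocallyOfFiniteType
      (Spec.map (CommRingCat.ofHom (algebraMap (Algebra.adjoin R (s : Set A)) B₀)))
    exact (HasRingHomProperty.Spec_iff (P := @LocallyOfFiniteType)).mpr
      (RingHom.finiteType_algebraMap.mpr inferInstance)
  · infer_instance

end CofilteredDescent

end AlgebraicGeometry

namespace AlgebraicGeometry.CofilteredDescent

/-- Induction on quasi-compact opens, adding one affine open at a time; quasi-separatedness keeps
the overlaps quasi-compact, as gluing requires. -/
lemma HasModel.of_isAffineOpen {I : Type u} [Category.{u} I] {D : I ⥤ Scheme.{u}} {c : Cone D}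
    [IsCofiltered I] [∀ {i j} (f : i ⟶ j), IsAffineHom (D.map f)]
    [∀ i, IsLocallyNoetherian (D.obj i)] (hc : IsLimit c) {X : Scheme.{u}} [CompactSpace X]
    [QuasiSeparatedSpace X] (f : X ⟶ c.pt)
    (H : ∀ U : X.Opens, IsAffineOpen U → HasModel c (U.ι ≫ f)) : HasModel c f := by
  have key : HasModel c ((⊤ : X.Opens).ι ≫ f) := by
    have : IsEmpty ((⊥ : X.Opens) : Scheme.{u}) := ⟨fun x ↦ x.2⟩
    refine compact_open_induction_on (P := fun U ↦ HasModel c (U.ι ≫ f)) ⊤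
      isCompact_univ (H _ isAffine_of_isEmpty) fun S hS U h ↦ ?_
    have : CompactSpace ((S ⊓ U.1 : X.Opens) : Scheme.{u}) := isCompact_iff_compactSpace.mp
      (QuasiSeparatedSpace.inter_isCompact _ _ S.2 hS U.1.2 U.2.isCompact)
    refine .of_isPullback_of_isOpenImmersion hc
      (j₁ := X.homOfLE le_sup_left) (j₂ := X.homOfLE le_sup_right) (k₁ := X.homOfLE inf_le_left)
      (k₂ := X.homOfLE inf_le_right) ?_ (isPullback_opens_inf_le _ _) ?_ ?_
    · rintro ⟨x, hx | hx⟩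
      · exact .inl ⟨⟨x, hx⟩, X.homOfLE_apply' _ _ _⟩
      · exact .inr ⟨⟨x, hx⟩, X.homOfLE_apply' _ _ _⟩
    · rwa [← Category.assoc, Scheme.homOfLE_ι]
    · rw [← Category.assoc, Scheme.homOfLE_ι]
      exact H _ U.2
  obtain ⟨i, Y, p, g, m⟩ := key
  refine ⟨i, Y, p, X.topIso.inv ≫ g, ?_, m.locallyOfFiniteType, m.compactSpace⟩
  exact m.isPullback.of_iso X.topIso (Iso.refl _) (Iso.refl _) (Iso.refl _)
    (Category.comp_id _) (by simp) (by simp) (by simp)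

/-- A quasi-compact and quasi-separated scheme locally of finite presentation over `A` is defined
over a finitely generated subalgebra of `A`. -/
theorem HasModel.of_locallyOfFinitePresentation (R : Type*) (A : Type u) [CommRing R] [CommRing A]
    [Algebra R A] [IsNoetherianRing R] {X : Scheme.{u}} [CompactSpace X] [QuasiSeparatedSpace X]
    (f : X ⟶ Spec (CommRingCat.of A)) [LocallyOfFinitePresentation f] :
    HasModel (specAdjoinCone R A) f :=
  .of_isAffineOpen (isLimitSpecAdjoinCone R A) _ fun U hU ↦
    have : IsAffine U := hU
    .of_isAffine R A (show _ ⟶ Spec (CommRingCat.of A) from U.ι ≫ f)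

end AlgebraicGeometry.CofilteredDescent

/-! ### Smoothness above the generic point -/

open TensorProduct in
/-- If the base change of `B` to an extension of the fraction field of `A` is smooth, then `B` is
smooth over a perfect subfield of `A` at every prime lying over the generic point. -/
lemma Algebra.IsSmoothAt.of_smooth_tensorProduct (Q A B k : Type*) [Field Q] [PerfectField Q]
    [CommRing A] [IsDomain A] [CommRing B] [Field k] [Algebra Q A] [Algebra A B] [Algebra Q B]
    [IsScalarTower Q A B] [Algebra A k] [FaithfulSMul A k] [Algebra.FiniteType Q A]
    [Algebra.Smooth k (k ⊗[A] B)] (q : Ideal B) [q.IsPrime]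
    (hq : q.comap (algebraMap A B) = ⊥) : Algebra.IsSmoothAt Q q := by
  let m := FractionRing A
  let : Algebra m k := FractionRing.liftAlgebra A k
  have : Algebra.EssFiniteType A m := .of_isLocalization _ (nonZeroDivisors A)
  have : Algebra.EssFiniteType Q m := .comp _ A _
  have : Algebra.Smooth k (k ⊗[m] (m ⊗[A] B)) :=
    .of_equiv (Algebra.TensorProduct.cancelBaseChange A m k k B).symm
  have : Algebra.Smooth m (m ⊗[A] B) := .of_smooth_tensorProduct_of_faithfullyFlat k
  -- `m` is formally smooth over `Q`, being an essentially finite type field extension of a perfect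
  -- field.
  have : Algebra.FormallySmooth Q (m ⊗[A] B) := .comp _ m _
  let : Algebra B (m ⊗[A] B) := Algebra.TensorProduct.rightAlgebra
  let S := Algebra.algebraMapSubmonoid B (nonZeroDivisors A)
  have : IsLocalization S (m ⊗[A] B) := inferInstance
  -- Nonzero elements of `A` stay outside `q`, so `Bq` is also a localization of the generic fibre
  -- `m ⊗[A] B`.
  have hS : S ≤ q.primeCompl := by
    rintro _ ⟨a, ha, rfl⟩ haq
    have : a ∈ q.comap (algebraMap A B) := haq
    rw [hq] at this
    exact nonZeroDivisors.ne_zero ha this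
  let Bq := Localization.AtPrime q
  let φ : m ⊗[A] B →ₐ[B] Bq := IsLocalization.liftAlgHom (M := S) (f := Algebra.ofId B Bq)
    fun s ↦ IsLocalization.map_units Bq (⟨s, hS s.2⟩ : q.primeCompl)
  let := φ.toAlgebra
  have : IsScalarTower B (m ⊗[A] B) Bq := .of_algebraMap_eq' φ.comp_algebraMap.symm
  have := IsLocalization.isLocalization_of_submonoid_le (m ⊗[A] B) Bq S q.primeCompl hS
  have : Algebra.FormallySmooth (m ⊗[A] B) Bq := .of_isLocalization
    (q.primeCompl.map (algebraMap B (m ⊗[A] B)))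
  have : IsScalarTower Q B (m ⊗[A] B) := .of_algebraMap_eq fun x ↦ by
    change algebraMap Q m x ⊗ₜ[A] (1 : B) = (1 : m) ⊗ₜ[A] algebraMap Q B x
    rw [IsScalarTower.algebraMap_apply Q A m, IsScalarTower.algebraMap_apply Q A B,
      Algebra.algebraMap_eq_smul_one (A := m), Algebra.algebraMap_eq_smul_one (A := B),
      TensorProduct.smul_tmul]
  have : IsScalarTower Q (m ⊗[A] B) Bq := .to₁₃₄ _ B _ _
  exact .comp _ (m ⊗[A] B) _

namespace AlgebraicGeometry

section

variable (Q : Type u) {A k : Type u} [Field Q] [PerfectField Q] [CommRing A] [IsDomain A] [Field k]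
  [Algebra Q A] [Algebra A k] [FaithfulSMul A k] [Algebra.FiniteType Q A] {X : Scheme.{u}}
  {f : X ⟶ Spec (CommRingCat.of k)} [Smooth f]

open TensorProduct in
lemma Scheme.Hom.mem_smoothLocus_of_isPullback_SpecMap {B : Type u} [CommRing B] [Algebra A B]
    [Algebra Q B] [IsScalarTower Q A B] {g : X ⟶ Spec (CommRingCat.of B)}
    (sq : IsPullback f g (Spec.map (CommRingCat.ofHom (algebraMap A k)))
      (Spec.map (CommRingCat.ofHom (algebraMap A B))))
    [LocallyOfFinitePresentation (Spec.map (CommRingCat.ofHom (algebraMap Q B)))] (x : X) :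
    g x ∈ (Spec.map (CommRingCat.ofHom (algebraMap Q B))).smoothLocus := by
  have : Algebra.FinitePresentation Q B := by
    rw [← RingHom.finitePresentation_algebraMap]
    exact (LocallyOfFinitePresentation.SpecMap_iff _).mp ‹_›
  have : Algebra.Smooth k (k ⊗[A] B) := by
    have sq' := isPullback_SpecMap_of_isPushout _ _ _ _ (CommRingCat.isPushout_tensorProduct A k B)
    have h : Smooth ((sq'.isoIsPullback _ _ sq).hom ≫ f) := inferInstance
    rw [sq'.isoIsPullback_hom_fst] at h
    rw [← RingHom.smooth_algebraMap]
    exact (HasRingHomProperty.Spec_iff (P := @Smooth)).mp h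
  let y : PrimeSpectrum B := g x
  let z : PrimeSpectrum k := f x
  -- The image of `X` lies over the generic point because `A` injects into the field `k`.
  have hy : y.asIdeal.comap (algebraMap A B) = ⊥ := by
    have h : z.asIdeal.comap (algebraMap A k) = y.asIdeal.comap (algebraMap A B) :=
      congr(PrimeSpectrum.asIdeal ($sq.w x))
    rw [← h, Ideal.eq_bot_of_prime z.asIdeal]
    exact RingHom.ker_eq_bot_iff_eq_zero _ |>.mpr fun a ha ↦
      FaithfulSMul.algebraMap_injective A k (ha.trans (map_zero _).symm)
  have := Algebra.IsSmoothAt.of_smooth_tensorProduct Q A B k y.asIdeal hy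
  -- Smoothness at a prime extends to a basic open neighbourhood.
  obtain ⟨b, hb, _⟩ := Algebra.IsSmoothAt.exists_notMem_smooth Q y.asIdeal
  let j : Spec (CommRingCat.of (Localization.Away b)) ⟶ Spec (CommRingCat.of B) :=
    Spec.map (CommRingCat.ofHom (algebraMap B (Localization.Away b)))
  have : IsOpenImmersion j := inferInstance
  have hj : j ≫ Spec.map (CommRingCat.ofHom (algebraMap Q B)) =
      Spec.map (CommRingCat.ofHom (algebraMap Q (Localization.Away b))) := by
    rw [← Spec.map_comp, ← CommRingCat.ofHom_comp, ← IsScalarTower.algebraMap_eq]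
  have : Smooth (j ≫ Spec.map (CommRingCat.ofHom (algebraMap Q B))) := by
    rw [hj]
    exact (HasRingHomProperty.Spec_iff (P := @Smooth)).mpr (RingHom.smooth_algebraMap.mpr ‹_›)
  obtain ⟨w, hw⟩ : g x ∈ Set.range j := by
    have : y ∈ Set.range (PrimeSpectrum.comap (algebraMap B (Localization.Away b))) := by
      rw [PrimeSpectrum.localization_away_comap_range _ b]
      exact hb
    exact this
  rw [← hw, ← Scheme.Hom.mem_preimage, Scheme.Hom.preimage_smoothLocus_eq,
    Scheme.Hom.smoothLocus_eq_top]
  trivial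

lemma Scheme.Hom.mem_smoothLocus_of_isPullback {Y : Scheme.{u}} {g : X ⟶ Y}
    {p : Y ⟶ Spec (CommRingCat.of A)}
    (sq : IsPullback f g (Spec.map (CommRingCat.ofHom (algebraMap A k))) p)
    [LocallyOfFinitePresentation (p ≫ Spec.map (CommRingCat.ofHom (algebraMap Q A)))] (x : X) :
    g x ∈ (p ≫ Spec.map (CommRingCat.ofHom (algebraMap Q A))).smoothLocus := by
  obtain ⟨B, j, _, y, hy⟩ : ∃ (B : CommRingCat.{u}) (j : Spec B ⟶ Y) (_ : IsOpenImmersion j)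
      (y : Spec B), j y = g x := by
    obtain ⟨U, hU, hxU, -⟩ := exists_isAffineOpen_mem_and_subset (U := ⊤) (Set.mem_univ (g x))
    exact ⟨_, hU.fromSpec, inferInstance, by rwa [← Set.mem_range, hU.range_fromSpec]⟩
  obtain ⟨ψ, hψ⟩ := Spec.map_surjective (j ≫ p)
  algebraize [ψ.hom, ψ.hom.comp (algebraMap Q A)]
  have sq' : IsPullback (pullback.fst g j ≫ f) (pullback.snd g j)
    (Spec.map (CommRingCat.ofHom (algebraMap A k)))
    (Spec.map (CommRingCat.ofHom (algebraMap A B))) := by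
    have := (IsPullback.of_hasPullback g j).paste_horiz sq
    rwa [← hψ] at this
  have hj : j ≫ p ≫ Spec.map (CommRingCat.ofHom (algebraMap Q A)) =
      Spec.map (CommRingCat.ofHom (algebraMap Q B)) := by
    rw [← Category.assoc, ← hψ, ← Spec.map_comp]
    rfl
  obtain ⟨z, rfl, rfl⟩ := exists_eq_of_isPullback (IsPullback.of_hasPullback g j) x y hy.symm
  rw [← hy, ← Scheme.Hom.mem_preimage, Scheme.Hom.preimage_smoothLocus_eq]
  have : LocallyOfFinitePresentation (Spec.map (CommRingCat.ofHom (algebraMap Q B))) :=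
    hj ▸ inferInstance
  simp only [hj]
  exact Scheme.Hom.mem_smoothLocus_of_isPullback_SpecMap Q sq' z

end

end AlgebraicGeometry

/-! ### Generic fibres and the choice of `Z` and `T` -/

namespace AlgebraicGeometry

lemma exists_SpecMap_comp_fromSpecStalk_eq {K : Type u} [Field K] {T : Scheme.{u}}
    (β : Spec (CommRingCat.of K) ⟶ T) (x : Spec (CommRingCat.of K)) (t : T) (h : β x = t) :
    ∃ ι : T.presheaf.stalk t ⟶ CommRingCat.of K, Spec.map ι ≫ T.fromSpecStalk t = β := by
  obtain rfl := Subsingleton.elim (IsLocalRing.closedPoint K) x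
  subst h
  exact ⟨Scheme.stalkClosedPointTo β, Scheme.Spec_stalkClosedPointTo_fromSpecStalk β⟩

lemma SpecMap_algebraMap_eq_genericPoint {A k : Type u} [CommRing A] [IsDomain A] [Field k]
    [Algebra A k] [FaithfulSMul A k] (x : Spec (CommRingCat.of k)) :
    Spec.map (CommRingCat.ofHom (algebraMap A k)) x = genericPoint (Spec (CommRingCat.of A)) := by
  rw [genericPoint_eq_bot_of_affine]
  let z : PrimeSpectrum k := x
  refine PrimeSpectrum.ext ?_
  change z.asIdeal.comap (algebraMap A k) = ⊥
  rw [Ideal.eq_bot_of_prime z.asIdeal]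
  exact RingHom.ker_eq_bot_iff_eq_zero _ |>.mpr fun a ha ↦
      FaithfulSMul.algebraMap_injective A k (ha.trans (map_zero _).symm)

lemma exists_iso_baseExtension {X Z T : Scheme.{u}} [IsIntegral T] {π : Z ⟶ T} {k : CommRingCat.{u}}
    {ι : T.functionField ⟶ k} {f : X ⟶ Spec k} {g : X ⟶ Z}
    (sq : IsPullback f g (Spec.map ι ≫ T.fromSpecStalk (genericPoint T)) π) :
    ∃ e : X ≅ baseExtension (genericFibreStr π) ι,
      e.hom ≫ baseExtensionStr (genericFibreStr π) ι = f := by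
  have sq₁ : IsPullback (genericFibreStr π) (pullback.fst _ _)
    (T.fromSpecStalk (genericPoint T)) π :=
    (IsPullback.of_hasPullback _ _).flip
  have sq₂ : IsPullback (baseExtensionStr (genericFibreStr π) ι) (pullback.fst _ _) (Spec.map ι)
    (genericFibreStr π) := (IsPullback.of_hasPullback _ _).flip
  have sq₃ := sq₂.flip.paste_horiz sq₁.flip
  exact ⟨sq.isoIsPullback _ _ sq₃.flip, sq.isoIsPullback_hom_fst _ _ _⟩

lemma isDominant_of_apply_eq_genericPoint {Z T : Scheme.{u}} [IsIntegral T] (π : Z ⟶ T) (z : Z)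
    (h : π z = genericPoint T) : IsDominant π := by
  refine ⟨fun t ↦ ?_⟩
  have : closure {genericPoint T} = Set.univ := genericPoint_spec T
  exact closure_mono (t := Set.range π) (Set.singleton_subset_iff.mpr ⟨z, h⟩)
    (this ▸ Set.mem_univ t)

/-- Allows `Y` to be shrunk to its smooth locus: an open subscheme containing the image of `X` has
the same base change. -/
lemma exists_isPullback_opens_ι_comp {X Y S T : Scheme.{u}} {f : X ⟶ T} {g : X ⟶ Y}
    {β : T ⟶ S} {p : Y ⟶ S} (sq : IsPullback f g β p) (U : Y.Opens) (h : ∀ x, g x ∈ U) :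
    ∃ g' : X ⟶ U, IsPullback f g' β (U.ι ≫ p) := by
  have hg : Set.range g ⊆ Set.range U.ι := by
    rintro _ ⟨x, rfl⟩
    rw [U.range_ι]
    exact h x
  have hU : (𝟙 X : X ⟶ X).opensRange = g ⁻¹ᵁ U.ι.opensRange := by
    rw [U.opensRange_ι, Scheme.Hom.opensRange_of_isIso]
    exact (top_unique fun x _ ↦ h x).symm
  have sq' : IsPullback (𝟙 X) (IsOpenImmersion.lift U.ι g hg) g U.ι :=
    (IsOpenImmersion.isPullback _ (𝟙 X) U.ι g (by simp) hU.symm).flip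
  exact ⟨_, by simpa using sq'.paste_horiz sq⟩

lemma exists_iso_baseExtension_of_isPullback (Q : Type u) {A k : Type u} [Field Q] [PerfectField Q]
    [CommRing A] [IsDomain A] [Field k] [Algebra Q A] [Algebra A k] [FaithfulSMul A k]
    [Algebra.FiniteType Q A] {X Y : Scheme.{u}} [Nonempty X] [CompactSpace Y]
    {f : X ⟶ Spec (CommRingCat.of k)} {g : X ⟶ Y} {p : Y ⟶ Spec (CommRingCat.of A)}
    [LocallyOfFiniteType p]
    (sq : IsPullback f g (Spec.map (CommRingCat.ofHom (algebraMap A k))) p) :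
    ∃ (Z T : Scheme.{u}) (_ : IsIntegral T) (sZ : Z ⟶ Spec (CommRingCat.of Q))
      (sT : T ⟶ Spec (CommRingCat.of Q)) (π : Z ⟶ T) (ι : T.functionField ⟶ CommRingCat.of k)
      (e : X ≅ baseExtension (genericFibreStr π) ι),
      IsVariety sZ ∧ IsVariety sT ∧ π ≫ sT = sZ ∧ IsDominant π ∧
      e.hom ≫ baseExtensionStr (genericFibreStr π) ι = f ∧ (Smooth f → Smooth sZ) := by
  let sT : Spec (CommRingCat.of A) ⟶ Spec (CommRingCat.of Q) :=
    Spec.map (CommRingCat.ofHom (algebraMap Q A))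
  have hsT : LocallyOfFiniteType sT := (HasRingHomProperty.Spec_iff (P := @LocallyOfFiniteType)).mpr
    (RingHom.finiteType_algebraMap.mpr inferInstance)
  have : LocallyOfFinitePresentation (p ≫ sT) :=
    LocallyOfFinitePresentation.iff_locallyOfFiniteType.mpr inferInstance
  have : IsNoetherian Y := { __ := LocallyOfFiniteType.isLocallyNoetherian (p ≫ sT) }
  obtain ⟨U, hU, hU'⟩ : ∃ U : Y.Opens, (∀ x, g x ∈ U) ∧ (Smooth f → Smooth (U.ι ≫ p ≫ sT)) := by
    -- `Z` is chosen before smoothness is assumed, hence the case split: the smooth locus over `Q`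
    -- if `f` is smooth, all of `Y` otherwise.
    by_cases hf : Smooth f
    · refine ⟨(p ≫ sT).smoothLocus, Scheme.Hom.mem_smoothLocus_of_isPullback Q sq, fun _ ↦ ?_⟩
      rw [← Scheme.Hom.smoothLocus_eq_top_iff,
        ← Scheme.Hom.preimage_smoothLocus_eq (Scheme.Opens.ι _) (p ≫ sT)]
      exact top_unique fun x _ ↦ x.2
    · exact ⟨⊤, fun _ ↦ trivial, fun h ↦ (hf h).elim⟩
  obtain ⟨g', sq'⟩ := exists_isPullback_opens_ι_comp sq U hU
  -- The image of a point of `X` lies over the generic point, which makes `π` dominant.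
  obtain ⟨x⟩ := ‹Nonempty X›
  obtain ⟨ι, hι⟩ := exists_SpecMap_comp_fromSpecStalk_eq _ _ _
    (SpecMap_algebraMap_eq_genericPoint (A := A) (f x))
  obtain ⟨e, he⟩ := exists_iso_baseExtension (hι ▸ sq')
  have : CompactSpace U :=
    isCompact_iff_compactSpace.mp (TopologicalSpace.NoetherianSpace.isCompact _)
  refine ⟨U, Spec (CommRingCat.of A), inferInstance, U.ι ≫ p ≫ sT, sT, U.ι ≫ p, ι, e,
    ⟨inferInstance, ?_⟩, ⟨hsT, inferInstance⟩, Category.assoc _ _ _,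
    isDominant_of_apply_eq_genericPoint _ (g' x) ?_, he, hU'⟩
  · exact (quasiCompact_iff_compactSpace _).mpr inferInstance
  · rw [← SpecMap_algebraMap_eq_genericPoint (k := k) (f x)]
    exact congr($sq'.w.symm x)

/-- A variety over an extension `k` of a perfect field `Q` is a base extension of the generic fibre
of a morphism of `Q`-varieties. -/
theorem exists_iso_baseExtension_genericFibreStr (Q : Type u) {k : Type u} [Field Q]
    [PerfectField Q] [Field k] [Algebra Q k] {X : Scheme.{u}} [Nonempty X]
    (f : X ⟶ Spec (CommRingCat.of k)) (hf : IsVariety f) :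
    ∃ (Z T : Scheme.{u}) (_ : IsIntegral T) (sZ : Z ⟶ Spec (CommRingCat.of Q))
      (sT : T ⟶ Spec (CommRingCat.of Q)) (π : Z ⟶ T) (ι : T.functionField ⟶ CommRingCat.of k)
      (e : X ≅ baseExtension (genericFibreStr π) ι),
      IsVariety sZ ∧ IsVariety sT ∧ π ≫ sT = sZ ∧ IsDominant π ∧
      e.hom ≫ baseExtensionStr (genericFibreStr π) ι = f ∧ (Smooth f → Smooth sZ) := by
  have := hf.locallyOfFiniteType
  have := hf.quasiCompact
  have : CompactSpace X := QuasiCompact.compactSpace_of_compactSpace f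
  -- Being locally Noetherian makes `X` quasi-separated, although `f` is not assumed separated.
  have : IsLocallyNoetherian X := LocallyOfFiniteType.isLocallyNoetherian f
  have : LocallyOfFinitePresentation f :=
    LocallyOfFinitePresentation.iff_locallyOfFiniteType.mpr inferInstance
  obtain ⟨⟨s⟩, Y, p, g, sq, hp, _⟩ :=
    CofilteredDescent.HasModel.of_locallyOfFinitePresentation Q k f
  have : Algebra.FiniteType Q (Algebra.adjoin Q (s : Set k)) := .adjoin_of_finite s.finite_toSet
  have : LocallyOfFiniteType
    (show Y ⟶ Spec (CommRingCat.of (Algebra.adjoin Q (s : Set k))) from p) := hp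
  exact exists_iso_baseExtension_of_isPullback Q (A := Algebra.adjoin Q (s : Set k)) sq

end AlgebraicGeometry

theorem theorem3p1 {k : Type u} [Field k] [CharZero k] (X : Scheme.{u}) [Nonempty X]
    (f : X ⟶ Spec (CommRingCat.of k)) (hf : IsVariety f) :
    ∃ (Z T : Scheme.{u}) (_ : IsIntegral T)
      (sZ : Z ⟶ Spec (CommRingCat.of (ULift.{u} ℚ)))
      (sT : T ⟶ Spec (CommRingCat.of (ULift.{u} ℚ)))
      (π : Z ⟶ T)
      (ι : T.functionField ⟶ CommRingCat.of k)
      (e : X ≅ baseExtension (genericFibreStr π) ι),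
      IsVariety sZ ∧ IsVariety sT ∧ π ≫ sT = sZ ∧ IsDominant π ∧
      e.hom ≫ baseExtensionStr (genericFibreStr π) ι = f ∧
      (Smooth f → Smooth sZ) := by
  -- `ULift` places `ℚ` in the universe of `k`; its characteristic being zero makes it perfect.
  let : Algebra (ULift.{u} ℚ) k := ((algebraMap ℚ k).comp ULift.ringEquiv.toRingHom).toAlgebra
  have : CharZero (ULift.{u} ℚ) :=
    charZero_of_injective_ringHom (f := (ULift.ringEquiv (R := ℚ)).symm.toRingHom)
      (ULift.ringEquiv (R := ℚ)).symm.injective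
  exact exists_iso_baseExtension_genericFibreStr (ULift.{u} ℚ) f hf
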